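/- Let $D=\mathbb{R}[x^{1/n}\mid n\ge 1]$ be the ring of finite sums $\sum_q r_q x^q$ with real coefficients and exponents in $\mathbb{Q}_{\ge 0}$, let $Q=\langle x^{1/n}\mid n\ge 1\rangle\subseteq D$, let $V=D_Q$ with maximal ideal $M$, let $R=\mathbb{Q}+M\subseteq V$, and let $\mathfrak m=M$, regarded as an ideal of $R$. Definitions. A module $X$ over a commutative ring is coherent if it is finitely generated and all its finitely generated submodules are finitely presented; a ring is coherent if it is coherent as a module over itself. A domain $A$ with fraction field $K$ is a pseudo-valuation domain if for every prime ideal $P$ and all $x,y\in K$, $xy\in P$ implies $x\in P$ or $y\in P$. An $R$-module $X$ is almost zero if $\mathfrak m X=0$; $\mathrm{Mod}_R^a$ is the Serre quotient of the category of $R$-modules by the almost zero modules, and $X\mapsto X^a$ is the localization functor. Modules $X,Y$ are almost isomorphic if $X^a\cong Y^a$. $X$ is almost finitely generated if for every $s\in\mathfrak m$ there is $f:R^n\to X$ with $s\,\mathrm{Coker} f=0$; it is almost finitely presented if for all $s,t\in\mathfrak m$ there is a complex $R^m\xrightarrow{g}R^n\xrightarrow{f}X$ with $s\,\mathrm{Coker}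 f=0$ and $t\,\mathrm{Ker} f\subseteq \mathrm{Im}\, g$. $X$ is almost coherent if it is almost finitely generated and every $R$-module $N$ that is almost finitely generated and admits a monomorphism $N^a\hookrightarrow X^a$ in $\mathrm{Mod}_R^a$ is almost finitely presented. $R$ is almost Noetherian if every ideal of $R$ is almost finitely generated. Then: 1. $Q$ is a maximal ideal of $D$, and $V$ is a valuation domain with value group $\mathbb{Q}$. 2. $R$ is a local pseudo-valuation domain with maximal ideal $\mathfrak m$, which is its only nonzero prime ideal; $R$ has Krull dimension $1$; $R$ is not coherent; $\mathfrak m$ is not finitely generated; $\mathfrak m^2=\mathfrak m$; and $\mathfrak m$ and $\mathfrak m\otimes_R\mathfrak m$ are flat $R$-modules. 3. $R$ is almost Noetherian, and $R$ is almost coherent as an $R$-module. 4. No coherent $R$-module is almost isomorphic to $R$. So an almost coherent module need not be almost isomorphic to a coherent one. 5. It is not the case that for every finitely generated ideal $\mathfrak m_0\subseteq\mathfrak m$ there are a coherent $R$-module $N$ and an $R$-linear map $f:N\to R$ with $\mathfrak m_0\,\mathrm{Ker} f=0$ and $\mathfrak m_0\,\mathrm{Coker} f=0$. As $R$ is almost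 coherent, this answers negatively Zavyalov's Question 2.6.6, which asks whether every almost coherent module admits such approximations by coherent modules. -/

import Mathlib

open CategoryTheory
open scoped TensorProduct NNRat

universe u

/-! ## Coherent modules, pseudo-valuation domains -/

/-- A module is coherent if it is finitely generated and each of its finitely generated
submodules is finitely presented. -/
def IsCoherentModule (R : Type u) [CommRing R] (M : Type u) [AddCommGroup M] [Module R M] :
    Prop :=
  Module.Finite R M ∧ ∀ N : Submodule R M, N.FG → Module.FinitePresentation R N

/-- A commutative ring is coherent if it is a coherent module over itself. -/
def IsCoherentRing (R : Type u) [CommRing R] : Prop :=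
  IsCoherentModule R R

/-- A pseudo-valuation domain: a domain `A` such that every prime ideal `P` is strongly prime,
i.e. for `x`, `y` in the fraction field, `x * y ∈ P` implies `x ∈ P` or `y ∈ P`. -/
def IsPseudoValuationDomain (A : Type u) [CommRing A] [IsDomain A] : Prop :=
  ∀ P : Ideal A, P.IsPrime → ∀ x y : FractionRing A,
    x * y ∈ algebraMap A (FractionRing A) '' (P : Set A) →
      x ∈ algebraMap A (FractionRing A) '' (P : Set A) ∨
        y ∈ algebraMap A (FractionRing A) '' (P : Set A)

/-! ## Almost mathematics over a ring `R` with an idempotent ideal `𝔪` -/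

namespace AlmostMath

section

variable {R : Type u} [CommRing R] (𝔪 : Ideal R)

/-- The almost zero modules, i.e. those with `𝔪 M = 0`. -/
def almostZero : ObjectProperty (ModuleCat.{u} R) :=
  fun M => 𝔪 • (⊤ : Submodule R M) = ⊥

theorem almostZero_iff (M : ModuleCat.{u} R) :
    almostZero 𝔪 M ↔ ∀ s ∈ 𝔪, ∀ x : M, s • x = 0 := by
  unfold almostZero
  rw [eq_bot_iff, Submodule.smul_le]
  exact ⟨fun h s hs x => (Submodule.mem_bot R).1 (h s hs x trivial),
    fun h s hs x _ => (Submodule.mem_bot R).2 (h s hs x)⟩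

/-- Almost zero modules form a Serre subcategory, since `𝔪` is idempotent. -/
instance almostZero_isSerreClass [h𝔪 : Fact (𝔪 * 𝔪 = 𝔪)] :
    (almostZero 𝔪).IsSerreClass where
  exists_zero := ⟨.of R PUnit, ModuleCat.isZero_of_subsingleton _, by
    rw [almostZero_iff]; intro s _ x; exact Subsingleton.elim _ _⟩
  prop_of_mono {M N} f hf hN := by
    rw [ModuleCat.mono_iff_injective] at hf
    rw [almostZero_iff] at hN ⊢
    intro s hs x
    apply hf
    rw [map_smul, map_zero]
    exact hN s hs (f x)
  prop_of_epi {M N} f hf hM := by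
    rw [ModuleCat.epi_iff_surjective] at hf
    rw [almostZero_iff] at hM ⊢
    intro s hs y
    obtain ⟨x, rfl⟩ := hf y
    rw [← map_smul, hM s hs x, map_zero]
  prop_X₂_of_shortExact {S} hS h₁ h₃ := by
    rw [almostZero_iff] at h₁ h₃ ⊢
    intro s hs x
    rw [← h𝔪.out] at hs
    induction hs using Submodule.mul_induction_on' with
    | mem_mul_mem a ha b hb =>
      have hb0 : S.g (b • x) = 0 := by rw [map_smul, h₃ b hb]
      obtain ⟨y, hy⟩ := (S.moduleCat_exact_iff.1 hS.exact) (b • x) hb0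
      rw [mul_smul, ← hy, ← map_smul, h₁ a ha, map_zero]
    | add a _ b _ ha hb => rw [add_smul, ha, hb, add_zero]

/-- The category of almost modules: the Serre quotient of all modules by the almost zero ones,
i.e. the localization at the morphisms with almost zero kernel and cokernel. -/
abbrev AlmostMod [Fact (𝔪 * 𝔪 = 𝔪)] :=
  (almostZero 𝔪).isoModSerre.Localization

/-- The localization functor `M ↦ Mᵃ`. -/
abbrev toAlmost [Fact (𝔪 * 𝔪 = 𝔪)] : ModuleCat.{u} R ⥤ AlmostMod 𝔪 :=
  (almostZero 𝔪).isoModSerre.Q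

/-- Two modules are almost isomorphic if they become isomorphic in the category of almost
modules. -/
def AlmostIsomorphic [Fact (𝔪 * 𝔪 = 𝔪)] (M N : ModuleCat.{u} R) : Prop :=
  Nonempty ((toAlmost 𝔪).obj M ≅ (toAlmost 𝔪).obj N)

/-- Almost finitely generated: for every `s ∈ 𝔪` there is `f : Rⁿ → M` whose cokernel is killed
by `s`. -/
def IsAlmostFG (M : Type u) [AddCommGroup M] [Module R M] : Prop :=
  ∀ s ∈ 𝔪, ∃ (n : ℕ) (f : (Fin n → R) →ₗ[R] M), ∀ x : M, s • x ∈ LinearMap.range f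

/-- Almost finitely presented: for all `s, t ∈ 𝔪` there is a complex `Rᵐ → Rⁿ → M` with maps
`g`, `f` such that `Coker f` is killed by `s` and `t Ker f ⊆ Im g`. -/
def IsAlmostFP (M : Type u) [AddCommGroup M] [Module R M] : Prop :=
  ∀ s ∈ 𝔪, ∀ t ∈ 𝔪, ∃ (n m : ℕ) (f : (Fin n → R) →ₗ[R] M)
    (g : (Fin m → R) →ₗ[R] (Fin n → R)),
    f ∘ₗ g = 0 ∧ (∀ x : M, s • x ∈ LinearMap.range f) ∧
      ∀ y ∈ LinearMap.ker f, t • y ∈ LinearMap.range g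

/-- Almost coherent: `M` is almost finitely generated, and every almost submodule `Nᵃ ⊆ Mᵃ`
with `N` almost finitely generated is almost finitely presented. -/
def IsAlmostCoherent [Fact (𝔪 * 𝔪 = 𝔪)] (M : ModuleCat.{u} R) : Prop :=
  IsAlmostFG 𝔪 M ∧
    ∀ (N : ModuleCat.{u} R) (i : (toAlmost 𝔪).obj N ⟶ (toAlmost 𝔪).obj M),
      Mono i → IsAlmostFG 𝔪 N → IsAlmostFP 𝔪 N

/-- The ring `R` is almost Noetherian if each of its ideals is almost finitely generated. -/
def IsAlmostNoetherianRing : Prop :=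
  ∀ I : Ideal R, IsAlmostFG 𝔪 I

end

end AlmostMath

/-! ## The ring `ℚ + M` -/

namespace PVDExample

noncomputable section

/-- `D = ℝ[x^{1/n} | n ≥ 1]`, as the ring of finite sums `∑ r_q x^q` with nonnegative rational
exponents `q`; see `adjoin_xroot`. -/
abbrev D : Type := AddMonoidAlgebra ℝ ℚ≥0

/-- The element `x^{1/n}` of `D` (for `n ≥ 1`). -/
def xroot (n : ℕ) : D := AddMonoidAlgebra.single (1 / (n : ℚ≥0)) 1

theorem xroot_pow (n k : ℕ) :
    xroot n ^ k = AddMonoidAlgebra.single ((k : ℚ≥0) / n) (1 : ℝ) := by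
  rw [xroot, AddMonoidAlgebra.single_pow, one_pow, nsmul_eq_mul, mul_one_div]

/-- The ring `D` is generated over `ℝ` by the elements `x^{1/n}`, `n ≥ 1`. -/
theorem adjoin_xroot : Algebra.adjoin ℝ {d : D | ∃ n : ℕ, 1 ≤ n ∧ d = xroot n} = ⊤ := by
  rw [eq_top_iff]
  rintro d -
  induction d using AddMonoidAlgebra.induction_linear with
  | zero => exact zero_mem _
  | add a b ha hb => exact add_mem ha hb
  | single q r =>
    have h : (AddMonoidAlgebra.single q r : D) = r • xroot q.den ^ q.num := by
      rw [xroot_pow, NNRat.num_div_den, AddMonoidAlgebra.smul_single, smul_eq_mul, mul_one]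
    have hx : xroot q.den ∈ {d : D | ∃ n : ℕ, 1 ≤ n ∧ d = xroot n} := ⟨q.den, q.den_pos, rfl⟩
    rw [h]
    exact Subalgebra.smul_mem _ (pow_mem (Algebra.subset_adjoin hx) _) _

/-- The ideal `Q` of `D` generated by the elements `x^{1/n}`, `n ≥ 1`. -/
def Q : Ideal D := Ideal.span {d : D | ∃ n : ℕ, 1 ≤ n ∧ d = xroot n}

theorem xroot_mem {n : ℕ} (hn : 1 ≤ n) : xroot n ∈ Q := Ideal.subset_span ⟨n, hn, rfl⟩

theorem single_mem {q : ℚ≥0} (hq : q ≠ 0) (r : ℝ) : (AddMonoidAlgebra.single q r : D) ∈ Q := by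
  have h : (AddMonoidAlgebra.single q r : D)
      = (AddMonoidAlgebra.single 0 r * xroot q.den ^ (q.num - 1)) * xroot q.den := by
    have h0 : q.num ≠ 0 := by simpa using hq
    rw [mul_assoc, ← pow_succ, Nat.sub_add_cancel (Nat.one_le_iff_ne_zero.2 h0), xroot_pow,
      NNRat.num_div_den, AddMonoidAlgebra.single_mul_single, zero_add, mul_one]
  rw [h]
  exact Q.mul_mem_left _ (xroot_mem q.den_pos)

/-- The evaluation `x^q ↦ 0` (for `q > 0`), i.e. the constant coefficient. -/
def constCoeff : D →ₐ[ℝ] ℝ :=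
  AddMonoidAlgebra.lift ℝ ℝ ℚ≥0
    { toFun := fun q => if q.toAdd = 0 then 1 else 0
      map_one' := by simp
      map_mul' := by
        intro a b
        by_cases ha : a.toAdd = 0 <;> by_cases hb : b.toAdd = 0 <;> simp [ha, hb] }

theorem Q_eq_ker : Q = RingHom.ker constCoeff := by
  apply le_antisymm
  · rw [Q, Ideal.span_le]
    rintro _ ⟨n, hn, rfl⟩
    have hn' : (n : ℚ≥0) ≠ 0 := by exact_mod_cast (Nat.one_le_iff_ne_zero.1 hn)
    simp [RingHom.mem_ker, constCoeff, xroot]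
    omega
  · intro d hd
    have key : ∀ d : D, d - AddMonoidAlgebra.single 0 (constCoeff d) ∈ Q := by
      intro d
      induction d using AddMonoidAlgebra.induction_linear with
      | zero => simp
      | add a b ha hb =>
        have := add_mem ha hb
        rw [map_add, AddMonoidAlgebra.single_add]
        convert this using 1
        ring
      | single q r =>
        by_cases hq : q = 0
        · subst hq
          simp [constCoeff]
        · have : constCoeff (AddMonoidAlgebra.single q r) = 0 := by simp [constCoeff, hq]
          rw [this, AddMonoidAlgebra.single_zero, sub_zero]
          exact single_mem hq r
    have := key d
    rw [RingHom.mem_ker] at hd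
    simpa [hd] using this

instance Q_isMaximal : Q.IsMaximal := by
  rw [Q_eq_ker]
  exact RingHom.ker_isMaximal_of_surjective _ fun r =>
    ⟨algebraMap ℝ D r, constCoeff.commutes r⟩

instance Q_isPrime : Q.IsPrime := Q_isMaximal.isPrime

/-- The localization `V = D_Q`. -/
abbrev V : Type := Localization.AtPrime Q

/-- The maximal ideal `M` of `V`. -/
abbrev M : Ideal V := IsLocalRing.maximalIdeal V

/-- The subring `ℚ + M` of `V`. -/
def ratAddM : Subring V where
  carrier := {v | ∃ q : ℚ, ∃ m ∈ M, v = algebraMap ℝ V (q : ℝ) + m}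
  zero_mem' := ⟨0, 0, zero_mem _, by simp⟩
  one_mem' := ⟨1, 0, zero_mem _, by simp⟩
  add_mem' := by
    rintro _ _ ⟨q, m, hm, rfl⟩ ⟨q', m', hm', rfl⟩
    exact ⟨q + q', m + m', add_mem hm hm', by rw [Rat.cast_add, map_add]; ring⟩
  neg_mem' := by
    rintro _ ⟨q, m, hm, rfl⟩
    exact ⟨-q, -m, neg_mem hm, by rw [Rat.cast_neg, map_neg]; ring⟩
  mul_mem' := by
    rintro _ _ ⟨q, m, hm, rfl⟩ ⟨q', m', hm', rfl⟩
    refine ⟨q * q', algebraMap ℝ V (q : ℝ) * m' + algebraMap ℝ V (q' : ℝ) * m + m * m',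
      add_mem (add_mem (M.mul_mem_left _ hm') (M.mul_mem_left _ hm)) (M.mul_mem_left _ hm'), ?_⟩
    rw [Rat.cast_mul, map_mul]
    ring

/-- The ring `R = ℚ + M`. -/
abbrev R : Type := ratAddM

/-- `M`, regarded as an ideal of `R = ℚ + M`. -/
def 𝔪 : Ideal R := M.comap ratAddM.subtype

theorem mem_𝔪 (r : R) : r ∈ 𝔪 ↔ (r : V) ∈ M := Iff.rfl

/-- The maximal ideal `M` is contained in `R`. -/
theorem mem_ratAddM {v : V} (hv : v ∈ M) : v ∈ ratAddM := ⟨0, v, hv, by simp⟩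

theorem Q_mul_Q : Q * Q = Q := by
  refine le_antisymm Ideal.mul_le_left ?_
  conv_lhs => rw [Q]
  rw [Ideal.span_le]
  rintro _ ⟨n, hn, rfl⟩
  have h : xroot n = xroot (2 * n) * xroot (2 * n) := by
    have hn' : (n : ℚ≥0) ≠ 0 := by exact_mod_cast (Nat.one_le_iff_ne_zero.1 hn)
    rw [← pow_two, xroot_pow, xroot]
    congr 1
    push_cast
    field_simp
  rw [h]
  exact Ideal.mul_mem_mul (xroot_mem (by omega)) (xroot_mem (by omega))

theorem M_mul_M : M * M = M := by
  have h : M = Q.map (algebraMap D V) := (Localization.AtPrime.map_eq_maximalIdeal).symm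
  rw [h, ← Ideal.map_mul, Q_mul_Q]

instance 𝔪_idempotent : Fact (𝔪 * 𝔪 = 𝔪) := ⟨by
  refine le_antisymm Ideal.mul_le_left ?_
  have key : ∀ v ∈ M * M, ∀ hv : v ∈ ratAddM, (⟨v, hv⟩ : R) ∈ 𝔪 * 𝔪 := by
    intro v hv
    induction hv using Submodule.mul_induction_on' with
    | mem_mul_mem a ha b hb =>
      intro _
      exact Ideal.mul_mem_mul (I := 𝔪) (J := 𝔪) (r := ⟨a, mem_ratAddM ha⟩)
        (s := ⟨b, mem_ratAddM hb⟩) ha hb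
    | add a ha b hb iha ihb =>
      intro _
      exact add_mem (iha (mem_ratAddM (M_mul_M ▸ ha))) (ihb (mem_ratAddM (M_mul_M ▸ hb)))
  intro r hr
  exact key r (M_mul_M.symm ▸ hr) r.2⟩

end

end PVDExample

/-! ### Order of vanishing on `V`. -/

namespace PVDExample

noncomputable section

/-! Every nonzero element of `V` is a power `x^q` times a unit, so divisibility in `V` is comparison
of orders in `ℚ≥0`. The subring `R` has the same maximal ideal as `V`; hence for elements of `R` a
strict inequality of orders already gives divisibility in `R`, with quotient in `𝔪`
(`exists_mem_𝔪_eq_mul`). Only elements of equal order see the difference between the residue fields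
`ℚ` and `ℝ`.

Density of the orders lets finitely many elements of `𝔪` share a divisor in `𝔪`, whence flatness
(`flat_𝔪`); the Archimedean property leaves one nonzero prime (`eq_𝔪_of_isPrime`). It also gives,
for `s ∈ 𝔪` and `I ≠ 0`, some nonzero `a ∈ I` with `s I ⊆ a R` (`exists_mem_forall_dvd_mul`). So
ideals are almost principal, and since `R` is a domain, an almost submodule of `R` is approximated
by a free module of rank at most one.

Coherence fails because of `√2`: the relations between `x` and `√2 x` form a copy of `{t | √2 t ∈ R}
= 𝔪`, which is not finitely generated by Nakayama. This obstruction survives multiplication by `x`,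
so it carries over to every module linked to `R` by maps whose kernels and cokernels are killed by
`x` (`not_isCoherentModule_of_relations`). -/

theorem constCoeff_eq_coeff (d : D) : constCoeff d = d.coeff 0 := by
  induction d using AddMonoidAlgebra.induction_linear with
  | zero => simp
  | add a b ha hb => simp [ha, hb]
  | single q r =>
    by_cases hq : q = 0
    · simp [constCoeff, hq]
    · simp [constCoeff, hq]

/-- Every nonzero element of `D` is a power of `x` times an element outside `Q`. -/
theorem exists_eq_single_mul {d : D} (hd : d ≠ 0) :
    ∃ q : ℚ≥0, ∃ e : D, e ∉ Q ∧ d = AddMonoidAlgebra.single q 1 * e := by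
  have hs : d.coeff.support.Nonempty := by
    rwa [Finsupp.support_nonempty_iff, ne_eq, AddMonoidAlgebra.coeff_eq_zero]
  -- The lowest exponent of `d`: dividing by `x^q` leaves no remainder and a nonzero constant
  -- coefficient.
  obtain ⟨q, hq, hmin⟩ := d.coeff.support.exists_min_image id hs
  refine ⟨q, d.divOf q, ?_, ?_⟩
  · rw [Q_eq_ker, RingHom.mem_ker]
    have := constCoeff_eq_coeff (d.divOf q)
    rw [AddMonoidAlgebra.coeff_divOf, add_zero] at this
    rw [Finsupp.mem_support_iff] at hq
    exact fun h => hq (this.symm.trans h)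
  · have h0 : d.modOf q = 0 := by
      ext g
      by_cases hg : ∃ p, g = q + p
      · simp [AddMonoidAlgebra.coeff_modOf_of_exists_add _ _ _ hg]
      · rw [AddMonoidAlgebra.coeff_modOf_of_not_exists_add _ _ _ hg]
        by_contra h
        exact hg (exists_add_of_le (hmin g (Finsupp.mem_support_iff.2 h)))
    have := AddMonoidAlgebra.divOf_add_modOf d q
    rw [h0, add_zero] at this
    exact this.symm

/-- The element `x^q` of `V`. -/
def xpow (q : ℚ≥0) : V := algebraMap D V (AddMonoidAlgebra.single q 1)

theorem xpow_zero : xpow 0 = 1 := map_one (algebraMap D V)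

theorem xpow_add (p q : ℚ≥0) : xpow (p + q) = xpow p * xpow q := by
  rw [xpow, xpow, xpow, ← map_mul, AddMonoidAlgebra.single_mul_single, one_mul]

theorem xpow_ne_zero (q : ℚ≥0) : xpow q ≠ 0 := by
  rw [xpow, ne_eq, FaithfulSMul.algebraMap_eq_zero_iff]
  simp

theorem xpow_mem {q : ℚ≥0} (hq : q ≠ 0) : xpow q ∈ M := by
  have h : M = Q.map (algebraMap D V) := Localization.AtPrime.map_eq_maximalIdeal.symm
  rw [h]
  exact Ideal.mem_map_of_mem _ (single_mem hq 1)

theorem isUnit_of_notMem {v : V} (hv : v ∉ M) : IsUnit v := by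
  simpa [IsLocalRing.mem_maximalIdeal] using hv

theorem notMem_of_isUnit {v : V} (hv : IsUnit v) : v ∉ M := by
  simpa [IsLocalRing.mem_maximalIdeal] using hv

/-- Every nonzero element of `V` is a power of `x` times a unit. -/
theorem exists_eq_xpow_mul {v : V} (hv : v ≠ 0) :
    ∃ q : ℚ≥0, ∃ u : V, IsUnit u ∧ v = xpow q * u := by
  obtain ⟨d, s, rfl⟩ := IsLocalization.exists_mk'_eq Q.primeCompl v
  have hd : d ≠ 0 := by
    rintro rfl
    exact hv (IsLocalization.mk'_zero _)
  obtain ⟨q, e, he, rfl⟩ := exists_eq_single_mul hd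
  refine ⟨q, IsLocalization.mk' V e s, ?_, ?_⟩
  · exact isUnit_of_notMem fun h => he ((IsLocalization.AtPrime.mk'_mem_maximal_iff V Q e s).1 h)
  · exact (IsLocalization.mul_mk'_eq_mk'_of_mul (S := V) _ e s).symm

theorem eq_zero_of_xpow_mul_isUnit {p : ℚ≥0} {u : V} (h : IsUnit (xpow p * u)) : p = 0 := by
  by_contra hp
  exact notMem_of_isUnit h (M.mul_mem_right _ (xpow_mem hp))

/-- Cancelling the smaller power would otherwise exhibit a unit as a multiple of a positive power of
`x`. As `v` is arbitrary, this gives both the uniqueness of the exponent and the criterion for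
divisibility by `x^q`. -/
theorem le_of_xpow_mul_eq {p q : ℚ≥0} {u v : V} (hu : IsUnit u)
    (h : xpow p * u = xpow q * v) : q ≤ p := by
  by_contra! hlt
  obtain ⟨r, rfl⟩ := exists_add_of_le hlt.le
  rw [xpow_add, mul_assoc] at h
  have h' := mul_left_cancel₀ (xpow_ne_zero p) h
  have := eq_zero_of_xpow_mul_isUnit (h' ▸ hu)
  simp [this] at hlt

open Classical in
/-- The order of vanishing at `x = 0` of an element of `V`. -/
def ord (v : V) : ℚ≥0 := if hv : v = 0 then 0 else (exists_eq_xpow_mul hv).choose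

theorem exists_eq_xpow_ord_mul {v : V} (hv : v ≠ 0) :
    ∃ u : V, IsUnit u ∧ v = xpow (ord v) * u := by
  rw [ord, dif_neg hv]
  exact (exists_eq_xpow_mul hv).choose_spec

/-- The element `0` is excluded because its order is `0` by convention, although every power of `x`
divides it. -/
theorem le_ord_iff {v : V} (hv : v ≠ 0) {q : ℚ≥0} : q ≤ ord v ↔ xpow q ∣ v := by
  obtain ⟨u, hu, h⟩ := exists_eq_xpow_ord_mul hv
  constructor
  · intro hq
    obtain ⟨r, hr⟩ := exists_add_of_le hq
    rw [h, hr, xpow_add, mul_assoc]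
    exact dvd_mul_right _ _
  · rintro ⟨w, hw⟩
    exact le_of_xpow_mul_eq hu (h.symm.trans hw)

theorem ord_xpow_mul (q : ℚ≥0) {u : V} (hu : IsUnit u) : ord (xpow q * u) = q := by
  have hne : xpow q * u ≠ 0 := mul_ne_zero (xpow_ne_zero q) hu.ne_zero
  apply le_antisymm
  · obtain ⟨w, hw⟩ := (le_ord_iff hne).1 le_rfl
    exact le_of_xpow_mul_eq hu hw
  · exact (le_ord_iff hne).2 (dvd_mul_right _ _)

theorem ord_xpow (q : ℚ≥0) : ord (xpow q) = q := by
  simpa using ord_xpow_mul q isUnit_one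

theorem ord_mul {v w : V} (hv : v ≠ 0) (hw : w ≠ 0) : ord (v * w) = ord v + ord w := by
  obtain ⟨a, ha, hva⟩ := exists_eq_xpow_ord_mul hv
  obtain ⟨b, hb, hwb⟩ := exists_eq_xpow_ord_mul hw
  rw [← ord_xpow_mul (ord v + ord w) (ha.mul hb), xpow_add]
  conv_lhs => rw [hva, hwb]
  congr 1
  ring

theorem ord_one : ord 1 = 0 := by rw [← xpow_zero, ord_xpow]

theorem ord_le_ord_iff {v w : V} (hv : v ≠ 0) (hw : w ≠ 0) : ord v ≤ ord w ↔ v ∣ w := by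
  obtain ⟨a, ha, hva⟩ := exists_eq_xpow_ord_mul hv
  rw [le_ord_iff hw]
  conv_rhs => rw [hva, ha.mul_right_dvd]

theorem mem_M_iff {v : V} (hv : v ≠ 0) : v ∈ M ↔ 0 < ord v := by
  rw [← not_iff_not, not_lt, ← ord_one, ord_le_ord_iff hv one_ne_zero, ← isUnit_iff_dvd_one]
  exact ⟨isUnit_of_notMem, notMem_of_isUnit⟩

/-- Strictness puts the quotient in `M`, hence in `R`; this is how divisibility descends from `V` to
`R`. -/
theorem exists_mem_mul_eq {v w : V} (hv : v ≠ 0) (hw : w ≠ 0) (h : ord v < ord w) :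
    ∃ m ∈ M, w = v * m := by
  obtain ⟨m, rfl⟩ := (ord_le_ord_iff hv hw).1 h.le
  have hm : m ≠ 0 := right_ne_zero_of_mul hw
  refine ⟨m, (mem_M_iff hm).2 ?_, rfl⟩
  rwa [ord_mul hv hm, lt_add_iff_pos_right] at h

theorem valuationRing_V : ValuationRing V := by
  rw [ValuationRing.iff_dvd_total]
  refine ⟨fun a b => ?_⟩
  by_cases ha : a = 0
  · exact Or.inr (ha ▸ dvd_zero b)
  by_cases hb : b = 0
  · exact Or.inl (hb ▸ dvd_zero a)
  rw [← ord_le_ord_iff ha hb, ← ord_le_ord_iff hb ha]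
  exact le_total _ _

/-! ### The valuation with value group `ℚ` -/

open Classical in
/-- The valuation of `V` given by the order of vanishing. -/
def ordValuation : Valuation V (WithZero (Multiplicative ℚ)) where
  toFun v := if v = 0 then 0 else WithZero.exp (-(ord v : ℚ))
  map_zero' := if_pos rfl
  map_one' := by simp [ord_one]
  map_mul' a b := by
    by_cases ha : a = 0
    · simp [ha]
    by_cases hb : b = 0
    · simp [hb]
    rw [if_neg (mul_ne_zero ha hb), if_neg ha, if_neg hb, ord_mul ha hb, ← WithZero.exp_add]
    congr 1
    push_cast
    ring
  map_add_le_max' a b := by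
    by_cases ha : a = 0
    · simp [ha]
    by_cases hb : b = 0
    · simp [hb]
    by_cases hab : a + b = 0
    · simp [hab]
    rw [if_neg hab, if_neg ha, if_neg hb, le_max_iff]
    simp only [WithZero.exp_le_exp, neg_le_neg_iff, NNRat.cast_le]
    rcases le_total (ord a) (ord b) with h | h
    · exact Or.inl ((ord_le_ord_iff ha hab).2 (dvd_add dvd_rfl ((ord_le_ord_iff ha hb).1 h)))
    · exact Or.inr ((ord_le_ord_iff hb hab).2 (dvd_add ((ord_le_ord_iff hb ha).1 h) dvd_rfl))

theorem ordValuation_of_ne_zero {v : V} (hv : v ≠ 0) :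
    ordValuation v = WithZero.exp (-(ord v : ℚ)) := if_neg hv

theorem ordValuation_eq_zero_iff {v : V} : ordValuation v = 0 ↔ v = 0 := by
  constructor
  · intro h
    by_contra hv
    rw [ordValuation_of_ne_zero hv] at h
    exact WithZero.exp_ne_zero h
  · rintro rfl
    exact map_zero _

theorem ordValuation_le_iff {v w : V} (hw : w ≠ 0) :
    ordValuation v ≤ ordValuation w ↔ w ∣ v := by
  by_cases hv : v = 0
  · simp [hv]
  · rw [ordValuation_of_ne_zero hv, ordValuation_of_ne_zero hw, ← ord_le_ord_iff hw hv,
      WithZero.exp_le_exp, neg_le_neg_iff, NNRat.cast_le]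

/-- The two algebra structures on `FractionRing V`, over the localization `V` of `D` and over the
domain `V`, agree. -/
theorem algebra_fractionRing_eq :
    (instAlgebraAtPrimeFractionRing V : Algebra V (FractionRing V)) =
      OreLocalization.instAlgebra := by
  refine Algebra.algebra_ext _ _ fun v => ?_
  refine DFunLike.congr_fun (f := (instAlgebraAtPrimeFractionRing V).algebraMap)
    (g := (OreLocalization.instAlgebra : Algebra V (FractionRing V)).algebraMap)
    (IsLocalization.ringHom_ext Q.primeCompl ?_) v
  refine RingHom.ext fun d => ?_
  exact IsLocalization.lift_eq (M := Q.primeCompl) (S := V) _ d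

instance isFractionRing_fractionRing : IsFractionRing V (FractionRing V) := by
  rw [IsFractionRing, algebra_fractionRing_eq]
  exact Localization.isLocalization

theorem nonZeroDivisors_le_primeCompl_supp :
    nonZeroDivisors V ≤ ordValuation.supp.primeCompl := by
  intro s hs h
  exact nonZeroDivisors.ne_zero hs (ordValuation_eq_zero_iff.1 h)

/-- The extension of `ordValuation` to the fraction field of `V`. -/
def fracValuation : Valuation (FractionRing V) (WithZero (Multiplicative ℚ)) :=
  ordValuation.extendToLocalization nonZeroDivisors_le_primeCompl_supp (FractionRing V)

theorem fracValuation_algebraMap (v : V) :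
    fracValuation (algebraMap V (FractionRing V) v) = ordValuation v :=
  Valuation.extendToLocalization_apply_map_apply _ _ _ _

theorem fracValuation_surjective : Function.Surjective fracValuation := by
  intro γ
  induction γ using WithZero.expRecOn with
  | zero => exact ⟨0, map_zero _⟩
  | exp a =>
    -- This is `x^(-a)`, written as a quotient because exponents in `V` are nonnegative; at least
    -- one of the two exponents is `0`.
    refine ⟨algebraMap V (FractionRing V) (xpow (-a).toNNRat) /
      algebraMap V (FractionRing V) (xpow a.toNNRat), ?_⟩
    rw [map_div₀, fracValuation_algebraMap, fracValuation_algebraMap,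
      ordValuation_of_ne_zero (xpow_ne_zero _), ordValuation_of_ne_zero (xpow_ne_zero _),
      ord_xpow, ord_xpow, ← WithZero.exp_sub]
    congr 1
    rcases le_total 0 a with h | h
    · simp [Rat.toNNRat_of_nonpos (neg_nonpos.2 h), Rat.coe_toNNRat _ h]
    · simp [Rat.toNNRat_of_nonpos h, Rat.coe_toNNRat _ (neg_nonneg.2 h)]

theorem fracValuation_integers : fracValuation.Integers V where
  hom_inj := IsFractionRing.injective V (FractionRing V)
  map_le_one v := by
    rw [fracValuation_algebraMap, ← map_one ordValuation, ordValuation_le_iff one_ne_zero]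
    exact one_dvd v
  exists_of_le_one k hk := by
    obtain ⟨a, b, hb, rfl⟩ := IsFractionRing.div_surjective (A := V) k
    have hb0 : b ≠ 0 := nonZeroDivisors.ne_zero hb
    have hb' : algebraMap V (FractionRing V) b ≠ 0 :=
      fun h => hb0 (IsFractionRing.injective V _ (h.trans (map_zero _).symm))
    rw [map_div₀, fracValuation_algebraMap, fracValuation_algebraMap,
      div_le_one₀ (zero_lt_iff.2 (ordValuation_eq_zero_iff.not.2 hb0)),
      ordValuation_le_iff hb0] at hk
    obtain ⟨c, rfl⟩ := hk
    exact ⟨c, by rw [map_mul, mul_div_cancel_left₀ _ hb']⟩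

/-! ### Structure of the ring `ℚ + M` -/

theorem algebraMap_mem_M_iff {r : ℝ} : algebraMap ℝ V r ∈ M ↔ r = 0 := by
  constructor
  · intro h
    by_contra hr
    exact notMem_of_isUnit ((isUnit_iff_ne_zero.2 hr).map (algebraMap ℝ V)) h
  · rintro rfl
    simp

theorem coe_ne_zero {r : R} (hr : r ≠ 0) : (r : V) ≠ 0 := fun h => hr (Subtype.ext h)

theorem isUnit_of_notMem_𝔪 {r : R} (hr : r ∉ 𝔪) : IsUnit r := by
  obtain ⟨v, q, m, hm, rfl⟩ := r
  rw [mem_𝔪] at hr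
  obtain ⟨u, hu⟩ := (isUnit_of_notMem hr).exists_right_inv
  have hq : (q : ℝ) ≠ 0 := fun h => hr (by simpa [h] using hm)
  have hqq : algebraMap ℝ V ((q⁻¹ : ℚ) : ℝ) * algebraMap ℝ V (q : ℝ) = 1 := by
    rw [← map_mul, Rat.cast_inv, inv_mul_cancel₀ hq, map_one]
  have huR : u ∈ ratAddM := by
    -- Solving `(q + m) u = 1` for `u` gives `u = q⁻¹ - q⁻¹ u m`.
    refine ⟨q⁻¹, -(algebraMap ℝ V ((q⁻¹ : ℚ) : ℝ) * u * m), neg_mem (M.mul_mem_left _ hm), ?_⟩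
    linear_combination algebraMap ℝ V ((q⁻¹ : ℚ) : ℝ) * hu - u * hqq
  exact IsUnit.of_mul_eq_one ⟨u, huR⟩ (Subtype.ext hu)

theorem one_notMem_𝔪 : (1 : R) ∉ 𝔪 := notMem_of_isUnit (v := 1) isUnit_one

theorem mem_𝔪_iff_not_isUnit {r : R} : r ∈ 𝔪 ↔ ¬ IsUnit r := by
  refine ⟨fun h hu => one_notMem_𝔪 ?_, not_imp_comm.1 isUnit_of_notMem_𝔪⟩
  rw [← 𝔪.eq_top_iff_one, 𝔪.eq_top_of_isUnit_mem h hu]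

instance isLocalRing_R : IsLocalRing R := by
  refine IsLocalRing.of_nonunits_add fun a b ha hb => ?_
  rw [mem_nonunits_iff, ← mem_𝔪_iff_not_isUnit] at *
  exact add_mem ha hb

theorem maximalIdeal_R : IsLocalRing.maximalIdeal R = 𝔪 := by
  ext r
  rw [IsLocalRing.mem_maximalIdeal, mem_nonunits_iff, mem_𝔪_iff_not_isUnit]

theorem isMaximal_𝔪 : 𝔪.IsMaximal := maximalIdeal_R ▸ IsLocalRing.maximalIdeal.isMaximal R

/-- Elements of `R` of larger order are divisible, with quotient in `𝔪`. -/
theorem exists_mem_𝔪_eq_mul {a b : R} (ha : a ≠ 0) (hb : b ≠ 0)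
    (h : ord (a : V) < ord (b : V)) : ∃ m ∈ 𝔪, b = a * m := by
  obtain ⟨m, hm, h⟩ := exists_mem_mul_eq (coe_ne_zero ha) (coe_ne_zero hb) h
  exact ⟨⟨m, mem_ratAddM hm⟩, hm, Subtype.ext h⟩

theorem ord_pos_of_mem_𝔪 {r : R} (hr : r ≠ 0) (h : r ∈ 𝔪) : 0 < ord (r : V) :=
  (mem_M_iff (coe_ne_zero hr)).1 h

theorem ord_coe_mul {a b : R} (ha : a ≠ 0) (hb : b ≠ 0) :
    ord ((a * b : R) : V) = ord (a : V) + ord (b : V) :=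
  ord_mul (coe_ne_zero ha) (coe_ne_zero hb)

/-- The element `x^q` of `R`, for `q ≠ 0`. -/
def xpowR (q : ℚ≥0) (hq : q ≠ 0) : R := ⟨xpow q, mem_ratAddM (xpow_mem hq)⟩

theorem xpowR_mem {q : ℚ≥0} (hq : q ≠ 0) : xpowR q hq ∈ 𝔪 := xpow_mem hq

theorem xpowR_ne_zero {q : ℚ≥0} (hq : q ≠ 0) : xpowR q hq ≠ 0 :=
  fun h => xpow_ne_zero q (congrArg Subtype.val h)

theorem ord_xpowR {q : ℚ≥0} (hq : q ≠ 0) : ord (xpowR q hq : V) = q := ord_xpow q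

theorem 𝔪_ne_bot : 𝔪 ≠ ⊥ := fun h =>
  xpowR_ne_zero one_ne_zero ((Submodule.mem_bot R).1 (h ▸ xpowR_mem one_ne_zero))

/-- Finitely many elements of `𝔪` have a common divisor in `𝔪`. -/
theorem exists_common_divisor {ι : Type*} (s : Finset ι) (f : ι → R) (hf : ∀ i ∈ s, f i ∈ 𝔪) :
    ∃ a ∈ 𝔪, a ≠ 0 ∧ ∀ i ∈ s, ∃ b ∈ 𝔪, f i = a * b := by
  classical
  induction s using Finset.induction_on with
  | empty => exact ⟨_, xpowR_mem one_ne_zero, xpowR_ne_zero one_ne_zero, by simp⟩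
  | insert j s hj ih =>
    obtain ⟨a, ha, ha0, h⟩ := ih fun i hi => hf i (Finset.mem_insert_of_mem hi)
    by_cases hfj : f j = 0
    · refine ⟨a, ha, ha0, fun i hi => ?_⟩
      rcases Finset.mem_insert.1 hi with rfl | hi
      · exact ⟨0, zero_mem _, by rw [hfj, mul_zero]⟩
      · exact h i hi
    -- Density of the exponents: `p` lies strictly below both orders, so the quotients by `x^p` stay
    -- in `𝔪`.
    · obtain ⟨p, hp0, hp⟩ := exists_between (lt_min (ord_pos_of_mem_𝔪 ha0 ha)
        (ord_pos_of_mem_𝔪 hfj (hf j (Finset.mem_insert_self _ _))))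
      rw [lt_min_iff] at hp
      refine ⟨_, xpowR_mem hp0.ne', xpowR_ne_zero hp0.ne', fun i hi => ?_⟩
      rcases Finset.mem_insert.1 hi with rfl | hi
      · exact exists_mem_𝔪_eq_mul (xpowR_ne_zero _) hfj (by rw [ord_xpowR]; exact hp.2)
      · obtain ⟨b, hb, hib⟩ := h i hi
        obtain ⟨c, hc, hac⟩ := exists_mem_𝔪_eq_mul (xpowR_ne_zero hp0.ne') ha0
          (by rw [ord_xpowR]; exact hp.1)
        exact ⟨c * b, 𝔪.mul_mem_left _ hb, by rw [hib, hac, mul_assoc]⟩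

theorem exists_mem_mul_mem {s : R} (hs : s ∈ 𝔪) : ∃ a ∈ 𝔪, ∃ b ∈ 𝔪, s = a * b := by
  obtain ⟨a, ha, -, h⟩ := exists_common_divisor {()} (fun _ => s) (by simpa using hs)
  obtain ⟨b, hb, h⟩ := h () (by simp)
  exact ⟨a, ha, b, hb, h⟩

/-- Archimedean argument: a high power of any nonzero `m ∈ 𝔪` has larger order than a given nonzero
`a ∈ P`, so it is a multiple of `a`. The `+ 1` in the bound makes the inequality strict, as
divisibility in `R` requires. -/
theorem eq_𝔪_of_isPrime {P : Ideal R} (hP : P.IsPrime) (h0 : P ≠ ⊥) : P = 𝔪 := by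
  refine le_antisymm (maximalIdeal_R ▸ IsLocalRing.le_maximalIdeal hP.ne_top) fun m hm => ?_
  obtain ⟨a, haP, ha⟩ := P.ne_bot_iff.1 h0
  by_cases hm0 : m = 0
  · exact hm0 ▸ zero_mem P
  obtain ⟨n, hn⟩ := Archimedean.arch (ord (a : V) + 1) (ord_pos_of_mem_𝔪 hm0 hm)
  have key : ∀ k : ℕ, ord ((m ^ k : R) : V) = k • ord (m : V) := by
    intro k
    induction k with
    | zero => simp [ord_one]
    | succ k ih => rw [pow_succ, ord_coe_mul (pow_ne_zero k hm0) hm0, ih, succ_nsmul]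
  obtain ⟨b, -, hb⟩ := exists_mem_𝔪_eq_mul ha (pow_ne_zero n hm0)
    ((lt_add_one _).trans_le (hn.trans_eq (key n).symm))
  exact hP.mem_of_pow_mem n (hb ▸ P.mul_mem_right _ haP)

theorem not_isField_R : ¬ IsField R := fun h => by
  obtain ⟨b, hb⟩ := h.mul_inv_cancel (xpowR_ne_zero one_ne_zero)
  exact mem_𝔪_iff_not_isUnit.1 (xpowR_mem one_ne_zero) (IsUnit.of_mul_eq_one _ hb)

theorem ringKrullDim_R : ringKrullDim R = 1 := by
  refine ringKrullDim_eq_one_iff_of_isLocalRing_isDomain.2 ⟨not_isField_R, fun x hx => ?_⟩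
  rw [Ideal.radical_eq_sInf, maximalIdeal_R]
  refine le_sInf fun J hJ => (eq_𝔪_of_isPrime hJ.2 ?_).ge
  rintro rfl
  exact hx (by simpa using hJ.1)

/-- Nakayama: a finitely generated `𝔪` with `𝔪 * 𝔪 = 𝔪` in a local ring would be zero. -/
theorem not_fg_𝔪 : ¬ 𝔪.FG := fun h =>
  𝔪_ne_bot (Submodule.eq_bot_of_le_smul_of_le_jacobson_bot 𝔪 𝔪 h 𝔪_idempotent.out.ge
    (maximalIdeal_R ▸ IsLocalRing.maximalIdeal_le_jacobson ⊥))

/-- Equational criterion: the elements of a relation are all multiples of one nonzero `a ∈ 𝔪`, and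
the relation can be divided by `a` because `R` is a domain. -/
instance flat_𝔪 : Module.Flat R 𝔪 := by
  refine Module.Flat.of_forall_isTrivialRelation fun {l f x} hfx => ?_
  obtain ⟨a, ha, ha0, h⟩ := exists_common_divisor Finset.univ (fun i => (x i : R))
    fun i _ => (x i).2
  choose b _ hb using fun i => h i (Finset.mem_univ i)
  refine ⟨1, fun i _ => b i, fun _ => ⟨a, ha⟩, fun i => ?_, fun _ => ?_⟩
  · ext1
    simp [hb, mul_comm]
  · have := congrArg Subtype.val hfx
    simp only [Submodule.coe_sum, Submodule.coe_smul, smul_eq_mul, hb, Submodule.coe_zero] at this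
    refine (mul_eq_zero.1 (?_ : a * _ = 0)).resolve_left ha0
    rw [← this, Finset.mul_sum]
    exact Finset.sum_congr rfl fun i _ => by ring

/-- For `a`, `b` in `R`, either `a` is a multiple of `b` by an element of `𝔪`, or `a` divides `b`
in `V`. -/
theorem exists_mem_𝔪_eq_mul_or (a b : R) :
    (∃ m ∈ 𝔪, a = b * m) ∨ (a : V) ∣ b := by
  by_cases ha : a = 0
  · exact Or.inl ⟨0, zero_mem _, by rw [ha, mul_zero]⟩
  by_cases hb : b = 0
  · exact Or.inr (by simp [hb])
  rcases lt_or_ge (ord (b : V)) (ord (a : V)) with h | h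
  · exact Or.inl (exists_mem_𝔪_eq_mul hb ha h)
  · exact Or.inr ((ord_le_ord_iff (coe_ne_zero ha) (coe_ne_zero hb)).1 h)

theorem isPseudoValuationDomain_R : IsPseudoValuationDomain R := by
  intro P hP x y hxy
  by_cases h0 : P = ⊥
  · subst h0
    simpa using hxy
  obtain rfl := eq_𝔪_of_isPrime hP h0
  obtain ⟨a, b, hb, rfl⟩ := IsFractionRing.div_surjective (A := R) x
  obtain ⟨c, d, hd, rfl⟩ := IsFractionRing.div_surjective (A := R) y
  obtain ⟨m, hm, hmxy⟩ := hxy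
  have hb0 := IsFractionRing.to_map_ne_zero_of_mem_nonZeroDivisors (K := FractionRing R) hb
  have hd0 := IsFractionRing.to_map_ne_zero_of_mem_nonZeroDivisors (K := FractionRing R) hd
  rcases exists_mem_𝔪_eq_mul_or a b with ⟨n, hn, rfl⟩ | ⟨v, hv⟩
  · exact Or.inl ⟨n, hn, by rw [map_mul, mul_div_cancel_left₀ _ hb0]⟩
  rcases exists_mem_𝔪_eq_mul_or c d with ⟨n, hn, rfl⟩ | ⟨w, hw⟩
  · exact Or.inr ⟨n, hn, by rw [map_mul, mul_div_cancel_left₀ _ hd0]⟩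
  -- Here `v` and `w` are inverses in `V` of the two fractions, so the product `m` of the fractions
  -- satisfies `m v w = 1`, against `m ∈ M`.
  exfalso
  have hR : m * (b * d) = a * c := by
    apply IsFractionRing.injective R (FractionRing R)
    rw [map_mul, hmxy]
    simp only [map_mul]
    field_simp
  have hV : (m : V) * (b * d) = a * c := congrArg Subtype.val hR
  have hbV := coe_ne_zero (nonZeroDivisors.ne_zero hb)
  have hdV := coe_ne_zero (nonZeroDivisors.ne_zero hd)
  have h1 : (b * d : V) * 1 = b * d * (m * (v * w)) := by
    calc (b * d : V) * 1 = (a * c) * (v * w) := by rw [hv, hw]; ring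
      _ = _ := by rw [← hV]; ring
  have := mul_left_cancel₀ (mul_ne_zero hbV hdV) h1
  exact notMem_of_isUnit isUnit_one (this ▸ M.mul_mem_right _ hm)

end

end PVDExample

/-! ### Morphisms of almost modules as roofs. -/

namespace AlmostMath

section

variable {A : Type u} [CommRing A] (I : Ideal A)

theorem monoModSerre_almostZero_iff [Fact (I * I = I)] {X Y : ModuleCat.{u} A} (f : X ⟶ Y) :
    (almostZero I).monoModSerre f ↔ ∀ s ∈ I, ∀ x : X, f x = 0 → s • x = 0 := by
  rw [ObjectProperty.monoModSerre_iff,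
    (almostZero I).prop_iff_of_iso (ModuleCat.kernelIsoKer f), almostZero_iff]
  refine forall₂_congr fun s _ => ⟨fun h x hx => ?_, fun h x => Subtype.ext (h x x.2)⟩
  exact congrArg Subtype.val (h ⟨x, hx⟩)

theorem epiModSerre_almostZero_iff [Fact (I * I = I)] {X Y : ModuleCat.{u} A} (f : X ⟶ Y) :
    (almostZero I).epiModSerre f ↔ ∀ s ∈ I, ∀ y : Y, ∃ x : X, f x = s • y := by
  rw [ObjectProperty.epiModSerre_iff,
    (almostZero I).prop_iff_of_iso (ModuleCat.cokernelIsoRangeQuotient f), almostZero_iff]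
  refine forall₂_congr fun s _ => ⟨fun h y => ?_, fun h y => ?_⟩
  · exact (Submodule.Quotient.mk_eq_zero _).1 (h (Submodule.Quotient.mk y))
  · obtain ⟨y, rfl⟩ := Submodule.Quotient.mk_surjective _ y
    exact (Submodule.Quotient.mk_eq_zero _).2 (h y)

/-- Every morphism of almost modules is represented by a roof whose left leg has almost zero
kernel and cokernel. -/
theorem exists_roof [Fact (I * I = I)] {X Y : ModuleCat.{u} A}
    (i : (toAlmost I).obj X ⟶ (toAlmost I).obj Y) :
    ∃ (Z : ModuleCat.{u} A) (s : Z ⟶ X) (f : Z ⟶ Y),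
      (almostZero I).isoModSerre s ∧ (toAlmost I).map s ≫ i = (toAlmost I).map f := by
  obtain ⟨φ, rfl⟩ := Localization.exists_rightFraction (toAlmost I) (almostZero I).isoModSerre i
  exact ⟨φ.X', φ.s, φ.f, φ.hs, φ.map_s_comp_map _ _⟩

/-- A monomorphism of almost modules is represented by a roof whose right leg has almost zero
kernel. -/
theorem exists_roof_of_mono [Fact (I * I = I)] {X Y : ModuleCat.{u} A}
    (i : (toAlmost I).obj X ⟶ (toAlmost I).obj Y) [Mono i] :
    ∃ (Z : ModuleCat.{u} A) (s : Z ⟶ X) (f : Z ⟶ Y),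
      (almostZero I).isoModSerre s ∧ (almostZero I).monoModSerre f ∧
        (toAlmost I).map s ≫ i = (toAlmost I).map f := by
  obtain ⟨Z, s, f, hs, h⟩ := exists_roof I i
  refine ⟨Z, s, f, hs, ?_, h⟩
  have := Localization.inverts (toAlmost I) (almostZero I).isoModSerre s hs
  rw [← ObjectProperty.SerreClassLocalization.mono_map_iff (toAlmost I), ← h]
  infer_instance

/-- An isomorphism of almost modules is represented by a roof both of whose legs have almost zero
kernel and cokernel. -/
theorem exists_roof_of_iso [Fact (I * I = I)] {X Y : ModuleCat.{u} A}
    (i : (toAlmost I).obj X ≅ (toAlmost I).obj Y) :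
    ∃ (Z : ModuleCat.{u} A) (s : Z ⟶ X) (f : Z ⟶ Y),
      (almostZero I).isoModSerre s ∧ (almostZero I).isoModSerre f := by
  obtain ⟨Z, s, f, hs, hf, h⟩ := exists_roof_of_mono I i.hom
  refine ⟨Z, s, f, hs, hf, ?_⟩
  have := Localization.inverts (toAlmost I) (almostZero I).isoModSerre s hs
  rw [← ObjectProperty.SerreClassLocalization.epi_map_iff (toAlmost I), ← h]
  infer_instance

end

end AlmostMath

namespace PVDExample

noncomputable section

/-! ### Almost Noetherian and almost coherent -/

/-- For `s ∈ 𝔪`, the multiple `s I` of an ideal `I` is contained in a principal ideal generated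
by an element of `I`. -/
theorem exists_mem_forall_dvd_mul (I : Ideal R) {s : R} (hs : s ∈ 𝔪) (hI : I ≠ ⊥) :
    ∃ a ∈ I, a ≠ 0 ∧ ∀ y ∈ I, a ∣ s * y := by
  obtain ⟨a₀, ha₀, h0⟩ := I.ne_bot_iff.1 hI
  by_cases hs0 : s = 0
  · exact ⟨a₀, ha₀, h0, by simp [hs0]⟩
  by_contra! hcon
  -- If `a` does not divide `s y`, then `s y` cannot have larger order than `a`. Each step therefore
  -- lowers the order by at least `ord s > 0`, which cannot continue forever since orders are
  -- nonnegative.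
  have step : ∀ a ∈ I, a ≠ 0 → ∃ y ∈ I, y ≠ 0 ∧ ord (s : V) + ord (y : V) ≤ ord (a : V) := by
    intro a ha ha0
    obtain ⟨y, hy, hay⟩ := hcon a ha ha0
    have hy0 : y ≠ 0 := by
      rintro rfl
      simp at hay
    refine ⟨y, hy, hy0, ?_⟩
    by_contra! hlt
    rw [← ord_coe_mul hs0 hy0] at hlt
    obtain ⟨m, -, hm⟩ := exists_mem_𝔪_eq_mul ha0 (mul_ne_zero hs0 hy0) hlt
    exact hay ⟨m, hm⟩
  have key : ∀ n : ℕ, ∃ y ∈ I, y ≠ 0 ∧ n • ord (s : V) + ord (y : V) ≤ ord (a₀ : V) := by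
    intro n
    induction n with
    | zero => exact ⟨a₀, ha₀, h0, by simp⟩
    | succ n ih =>
      obtain ⟨y, hy, hy0, hle⟩ := ih
      obtain ⟨z, hz, hz0, hle'⟩ := step y hy hy0
      refine ⟨z, hz, hz0, le_trans ?_ hle⟩
      rw [succ_nsmul, add_assoc]
      gcongr
  obtain ⟨n, hn⟩ := Archimedean.arch (ord (a₀ : V) + 1) (ord_pos_of_mem_𝔪 hs0 hs)
  obtain ⟨y, -, -, hle⟩ := key n
  exact absurd (le_self_add.trans hle) (not_le.2 ((lt_add_one _).trans_le hn))

theorem isAlmostNoetherianRing_𝔪 : AlmostMath.IsAlmostNoetherianRing 𝔪 := by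
  intro I s hs
  by_cases hI : I = ⊥
  · subst hI
    exact ⟨0, 0, fun x => ⟨0, Subsingleton.elim _ _⟩⟩
  obtain ⟨a, ha, -, h⟩ := exists_mem_forall_dvd_mul I hs hI
  refine ⟨1, (LinearMap.toSpanSingleton R I ⟨a, ha⟩).comp (LinearMap.proj 0), fun x => ?_⟩
  obtain ⟨c, hc⟩ := h x x.2
  exact ⟨fun _ => c, Subtype.ext (by simp [hc, mul_comm])⟩

/-- A roof `N ← Z → R` representing the monomorphism replaces `N` by the ideal `range f`. If this
ideal is nonzero, it is almost generated by one `a = f z`, and `σ z` almost generates `N` with no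
relations at all. -/
theorem isAlmostCoherent_R : AlmostMath.IsAlmostCoherent 𝔪 (ModuleCat.of R R) := by
  refine ⟨fun s _ => ⟨1, LinearMap.proj 0, fun x => ⟨fun _ => s • x, rfl⟩⟩, ?_⟩
  intro N i _ _ s hs t _
  obtain ⟨Z, σ, f, hσ, hf, -⟩ := AlmostMath.exists_roof_of_mono 𝔪 i
  rw [AlmostMath.monoModSerre_almostZero_iff] at hf
  have hσm := (AlmostMath.monoModSerre_almostZero_iff 𝔪 σ).1 hσ.1
  have hσe := (AlmostMath.epiModSerre_almostZero_iff 𝔪 σ).1 hσ.2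
  -- Three factors of `s` for three losses: `s₃` lifts an element of `N` to `Z`, `s₂` moves its
  -- image under `f` into `a R`, and `s₁` kills the remaining error in the kernel of `f`.
  obtain ⟨s₁, hs₁, s', hs', rfl⟩ := exists_mem_mul_mem hs
  obtain ⟨s₂, hs₂, s₃, hs₃, rfl⟩ := exists_mem_mul_mem hs'
  by_cases hI : LinearMap.range f.hom = ⊥
  · refine ⟨0, 0, 0, 0, LinearMap.zero_comp _, fun x => ⟨0, ?_⟩,
      fun y _ => ⟨0, Subsingleton.elim _ _⟩⟩
    obtain ⟨z, hz⟩ := hσe s₃ hs₃ x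
    have hfz : f z = 0 := (Submodule.mem_bot R).1 (hI ▸ LinearMap.mem_range_self f.hom z)
    rw [mul_smul, mul_smul, ← hz, ← map_smul σ.hom, hf s₂ hs₂ z hfz, map_zero, map_zero,
      smul_zero]
  obtain ⟨a, ⟨z, hz⟩, ha, hdvd⟩ := exists_mem_forall_dvd_mul (LinearMap.range f.hom) hs₂ hI
  refine ⟨1, 0, (LinearMap.toSpanSingleton R N (σ z)).comp (LinearMap.proj 0), 0,
    LinearMap.comp_zero _, fun x => ?_, fun y hy => ⟨0, ?_⟩⟩
  · obtain ⟨w, hw⟩ := hσe s₃ hs₃ x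
    obtain ⟨c, hc⟩ := hdvd (f w) (LinearMap.mem_range_self f.hom w)
    have h0 : f (s₂ • w - c • z) = 0 := by
      change f.hom _ = 0
      change f.hom z = a at hz
      rw [map_sub, map_smul, map_smul, hz, smul_eq_mul, smul_eq_mul, mul_comm c, ← hc]
      exact sub_self _
    have h1 := congrArg σ.hom (hf s₁ hs₁ _ h0)
    rw [map_zero, map_smul, map_sub, map_smul, map_smul, smul_sub, sub_eq_zero] at h1
    refine ⟨fun _ => s₁ * c, ?_⟩
    simp only [LinearMap.comp_apply, LinearMap.proj_apply, LinearMap.toSpanSingleton_apply]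
    rw [mul_smul, mul_smul, mul_smul, ← hw]
    exact h1.symm
  -- A relation `y₀ σ(z) = 0` gives `x y₀ z = 0` in `Z`, and applying `f` gives `x y₀ a = 0` in the
  -- domain `R`.
  · have hy0 : y 0 = 0 := by
      have h1 : σ (y 0 • z) = 0 := (map_smul σ.hom _ _).trans hy
      have h2 := congrArg f.hom (hσm _ (xpowR_mem one_ne_zero) _ h1)
      rw [map_zero, map_smul, map_smul, hz] at h2
      exact (mul_eq_zero.1 ((mul_eq_zero.1 h2).resolve_left
        (xpowR_ne_zero one_ne_zero))).resolve_right ha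
    rw [LinearMap.zero_apply]
    ext j
    rw [Subsingleton.elim j 0]
    simp [hy0]

/-! ### Failure of coherence -/

/-- The unit `√2` of `V`, which does not belong to `R`. -/
def sqrtTwo : V := algebraMap ℝ V (√2)

/-- Modulo `M`, membership says that `√2 q` is rational for the residue `q ∈ ℚ` of `r`, which forces
`q = 0`. -/
theorem sqrtTwo_mul_coe_mem_iff {r : R} : sqrtTwo * r ∈ ratAddM ↔ r ∈ 𝔪 := by
  refine ⟨?_, fun h => mem_ratAddM (M.mul_mem_left _ h)⟩
  obtain ⟨v, q, m, hm, rfl⟩ := r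
  rintro ⟨q', m', hm', h⟩
  have h1 : algebraMap ℝ V (√2 * q - q') ∈ M := by
    have : algebraMap ℝ V (√2 * q - q') = m' - sqrtTwo * m := by
      rw [map_sub, map_mul]
      rw [mul_add] at h
      unfold sqrtTwo at *
      linear_combination h
    exact this ▸ sub_mem hm' (M.mul_mem_left _ hm)
  rw [algebraMap_mem_M_iff, sub_eq_zero] at h1
  have hq : q = 0 := by
    by_contra hq
    exact (irrational_sqrt_two.mul_ratCast hq).ne_rat _ h1
  simpa [mem_𝔪, hq] using hm

/-- A coherent module contains no two elements whose only relations are those between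
`1` and `√2` in `V`: the module of these relations is isomorphic to `𝔪`. -/
theorem not_isCoherentModule_of_relations {N : Type} [AddCommGroup N] [Module R N] (p p' : N)
    (h : ∀ r t : R, r • p + t • p' = 0 ↔ (r : V) + sqrtTwo * t = 0) :
    ¬ IsCoherentModule R N := by
  intro hN
  let g : (R × R) →ₗ[R] N :=
    (LinearMap.toSpanSingleton R N p).coprod (LinearMap.toSpanSingleton R N p')
  have := hN.2 (LinearMap.range g) (Submodule.fg_range g)
  have hker : (LinearMap.ker g.rangeRestrict).FG :=
    Module.FinitePresentation.fg_ker _ g.surjective_rangeRestrict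
  rw [LinearMap.ker_rangeRestrict] at hker
  apply not_fg_𝔪
  -- The second coordinate `t` of a relation determines the first as `-√2 t`, and `t` occurs exactly
  -- when `√2 t ∈ R`.
  suffices h𝔪 : 𝔪 = (LinearMap.ker g).map (LinearMap.snd R R R) from
    h𝔪 ▸ hker.map (LinearMap.snd R R R)
  ext t
  simp only [Submodule.mem_map, LinearMap.mem_ker, Prod.exists, LinearMap.snd_apply,
    exists_eq_right, g, LinearMap.coprod_apply, LinearMap.toSpanSingleton_apply, h,
    ← sqrtTwo_mul_coe_mem_iff]
  constructor
  · intro ht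
    exact ⟨-⟨_, ht⟩, neg_add_cancel _⟩
  · rintro ⟨r, hr⟩
    rw [← neg_eq_of_add_eq_zero_right hr]
    exact neg_mem r.2

/-- The element `√2 x` of `R`. -/
def sqrtTwoX : R := ⟨sqrtTwo * xpow 1, mem_ratAddM (M.mul_mem_left _ (xpow_mem one_ne_zero))⟩

/-- The element `x` of `R`. -/
def X : R := xpowR 1 one_ne_zero

theorem X_mem : X ∈ 𝔪 := xpowR_mem _

theorem X_ne_zero : X ≠ 0 := xpowR_ne_zero _

/-- Multiplying by `x` brings the pair `1, √2` into `R` without changing its relations, since `V` is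
a domain. -/
theorem mul_X_add_mul_sqrtTwoX_eq_zero_iff (r t : R) :
    r * X + t * sqrtTwoX = 0 ↔ (r : V) + sqrtTwo * t = 0 := by
  have h : ((r * X + t * sqrtTwoX : R) : V) = (r + sqrtTwo * t) * xpow 1 := by
    change (r : V) * xpow 1 + t * (sqrtTwo * xpow 1) = _
    ring
  rw [← Subring.coe_eq_zero_iff, h, mul_eq_zero, or_iff_left (xpow_ne_zero 1)]

theorem not_isCoherentRing_R : ¬ IsCoherentRing R :=
  not_isCoherentModule_of_relations X sqrtTwoX mul_X_add_mul_sqrtTwoX_eq_zero_iff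

/-- On a roof `P ← Z → R`, the elements `x²` and `x · √2 x` lift to `z` and `z'` in `Z`. The kernels
of both legs are killed by `x`, so after one more factor `x` the images of `z` and `z'` in `P` have
exactly the relations of `x` and `√2 x`. -/
theorem not_almostIsomorphic_of_isCoherentModule (P : ModuleCat.{0} R)
    (hP : IsCoherentModule R P) :
    ¬ AlmostMath.AlmostIsomorphic 𝔪 P (ModuleCat.of R R) := by
  rintro ⟨i⟩
  obtain ⟨Z, s, f, hs, hf⟩ := AlmostMath.exists_roof_of_iso 𝔪 i
  have hs := (AlmostMath.monoModSerre_almostZero_iff 𝔪 s).1 hs.1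
  have hfm := (AlmostMath.monoModSerre_almostZero_iff 𝔪 f).1 hf.1
  have hfe := (AlmostMath.epiModSerre_almostZero_iff 𝔪 f).1 hf.2
  obtain ⟨z, hz⟩ := hfe X X_mem X
  obtain ⟨z', hz'⟩ := hfe X X_mem sqrtTwoX
  have hlin (r t : R) : f.hom (r • z + t • z') = X * (r * X + t * sqrtTwoX) := by
    rw [map_add, map_smul, map_smul]
    change r * f z + t * f z' = _
    rw [hz, hz']
    change r * (X * X) + t * (X * sqrtTwoX) = _
    ring
  refine not_isCoherentModule_of_relations (s.hom (X • z)) (s.hom (X • z')) (fun r t => ?_) hP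
  have hsum : r • s.hom (X • z) + t • s.hom (X • z') = s.hom (X • (r • z + t • z')) := by
    simp only [map_smul, map_add, smul_add, smul_comm X]
  rw [hsum, ← mul_X_add_mul_sqrtTwoX_eq_zero_iff]
  constructor
  · intro h
    have := congrArg f.hom (hs X X_mem _ h)
    rw [map_zero, map_smul, map_smul, hlin] at this
    simpa [X_ne_zero] using this
  · intro h
    have h0 : f (r • z + t • z') = 0 := (hlin r t).trans (by rw [h, mul_zero])
    rw [hfm X X_mem _ h0, map_zero]

/-- The single ideal `𝔪₀ = (x)` is already a counterexample: the previous argument uses only that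
`x` kills kernels and cokernels, and here `f` itself takes the place of the roof. -/
theorem not_forall_exists_coherent_approximation :
    ¬ (∀ 𝔪₀ : Ideal R, 𝔪₀ ≤ 𝔪 → 𝔪₀.FG →
      ∃ (N : ModuleCat.{0} R) (f : N →ₗ[R] R),
        IsCoherentModule R N ∧
        𝔪₀ • LinearMap.ker f = ⊥ ∧
        𝔪₀ • (⊤ : Submodule R (R ⧸ LinearMap.range f)) = ⊥) := by
  intro H
  obtain ⟨N, f, hN, hker, hcoker⟩ := H (Ideal.span {X})
    ((Ideal.span_singleton_le_iff_mem 𝔪).2 X_mem) (Submodule.fg_span_singleton X)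
  have hX : X ∈ Ideal.span {X} := Ideal.mem_span_singleton_self X
  have hk (z : N) (hz : f z = 0) : X • z = 0 :=
    (Submodule.mem_bot R).1 (hker ▸ Submodule.smul_mem_smul hX hz)
  have hc (y : R) : ∃ z, f z = X * y := by
    have h : X • (Submodule.Quotient.mk y : R ⧸ LinearMap.range f) = 0 :=
      (Submodule.mem_bot R).1 (hcoker ▸ Submodule.smul_mem_smul hX trivial)
    exact (Submodule.Quotient.mk_eq_zero _).1 h
  obtain ⟨z, hz⟩ := hc X
  obtain ⟨z', hz'⟩ := hc sqrtTwoX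
  refine not_isCoherentModule_of_relations (X • z) (X • z') (fun r t => ?_) hN
  have hlin : f (r • z + t • z') = X * (r * X + t * sqrtTwoX) := by
    rw [map_add, map_smul, map_smul, hz, hz', smul_eq_mul, smul_eq_mul]
    ring
  have hsum : r • X • z + t • X • z' = X • (r • z + t • z') := by
    simp only [smul_add, smul_comm X]
  rw [hsum, ← mul_X_add_mul_sqrtTwoX_eq_zero_iff]
  constructor
  · intro h
    have := congrArg f h
    rw [map_zero, map_smul, hlin] at this
    simpa [X_ne_zero] using this
  · intro h
    exact hk _ (by rw [hlin, h, mul_zero])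

end

end PVDExample

theorem mainTheorem4 :
    -- the ring `V = D_Q` and its maximal ideal `M`
    PVDExample.Q.IsMaximal ∧
    ValuationRing PVDExample.V ∧
    (∃ v : Valuation (FractionRing PVDExample.V) (WithZero (Multiplicative ℚ)),
      Function.Surjective v ∧ v.Integers PVDExample.V) ∧
    -- the ring `R = ℚ + M` and its ideal `𝔪 = M`
    IsPseudoValuationDomain PVDExample.R ∧
    IsLocalRing PVDExample.R ∧
    PVDExample.𝔪.IsMaximal ∧
    (∀ P : Ideal PVDExample.R, P.IsPrime → P ≠ ⊥ → P = PVDExample.𝔪) ∧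
    ringKrullDim PVDExample.R = 1 ∧
    ¬ IsCoherentRing PVDExample.R ∧
    ¬ PVDExample.𝔪.FG ∧
    PVDExample.𝔪 * PVDExample.𝔪 = PVDExample.𝔪 ∧
    Module.Flat PVDExample.R PVDExample.𝔪 ∧
    Module.Flat PVDExample.R (PVDExample.𝔪 ⊗[PVDExample.R] PVDExample.𝔪) ∧
    -- `R` is almost Noetherian and almost coherent
    AlmostMath.IsAlmostNoetherianRing PVDExample.𝔪 ∧
    AlmostMath.IsAlmostCoherent PVDExample.𝔪 (ModuleCat.of PVDExample.R PVDExample.R) ∧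
    -- `R` is not almost isomorphic to a coherent module
    (∀ P : ModuleCat.{0} PVDExample.R, IsCoherentModule PVDExample.R P →
      ¬ AlmostMath.AlmostIsomorphic PVDExample.𝔪
        P (ModuleCat.of PVDExample.R PVDExample.R)) ∧
    -- nor can it be approximated by coherent modules, up to finitely generated `𝔪₀ ⊆ 𝔪`
    ¬ (∀ 𝔪₀ : Ideal PVDExample.R, 𝔪₀ ≤ PVDExample.𝔪 → 𝔪₀.FG →
      ∃ (N : ModuleCat.{0} PVDExample.R) (f : N →ₗ[PVDExample.R] PVDExample.R),
        IsCoherentModule PVDExample.R N ∧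
        𝔪₀ • LinearMap.ker f = ⊥ ∧
        𝔪₀ • (⊤ : Submodule PVDExample.R (PVDExample.R ⧸ LinearMap.range f)) = ⊥) := by
  exact ⟨PVDExample.Q_isMaximal, PVDExample.valuationRing_V,
    ⟨PVDExample.fracValuation, PVDExample.fracValuation_surjective,
      PVDExample.fracValuation_integers⟩,
    PVDExample.isPseudoValuationDomain_R, PVDExample.isLocalRing_R, PVDExample.isMaximal_𝔪,
    fun _ hP h0 => PVDExample.eq_𝔪_of_isPrime hP h0, PVDExample.ringKrullDim_R,
    PVDExample.not_isCoherentRing_R, PVDExample.not_fg_𝔪, PVDExample.𝔪_idempotent.out,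
    PVDExample.flat_𝔪, inferInstance, PVDExample.isAlmostNoetherianRing_𝔪,
    PVDExample.isAlmostCoherent_R, PVDExample.not_almostIsomorphic_of_isCoherentModule,
    PVDExample.not_forall_exists_coherent_approximation⟩
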